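/- Let $(R_0,\mathfrak m)$ be an Artinian local ring that is equicharacteristic (that is, $R_0$ and $R_0/\mathfrak m$ have the same characteristic), let $R=R_0[X_1,\dots,X_b]$ with its standard grading, and let $I\subseteq R_+=(X_1,\dots,X_b)$ be a homogeneous ideal such that $\dim(R/I)\ge 1$. Write $\lambda_{R_0}$ for length over $R_0$, and let $h_{R/I}\in\mathbb Q[X]$ be the Hilbert polynomial of $R/I$, i.e. the polynomial with $h_{R/I}(n)=\lambda_{R_0}(R_n/I_n)$ for all sufficiently large $n$. Here $\binom{X+a}{k}$ denotes the polynomial $(X+a)(X+a-1)\cdots(X+a-k+1)/k!$. Let $$h_{R/I}(X)=q\binom{X+b-1}{b-1}+\binom{X+c'_1}{c'_1}+\binom{X+c'_2-1}{c'_2}+\dots+\binom{X+c'_p-(p-1)}{c'_p}$$ with integers $b-1>c'_1\ge\dots\ge c'_p\ge 0$, $p\ge 0$, $0\le q\le\lambda_{R_0}(R_0)$, and $$h_{R/I}(X)=\binom{X+c_1}{c_1}+\binom{X+c_2-1}{c_2}+\dots+\binom{X+c_s-(s-1)}{c_s}$$ with integers $c_1\ge\dots\ge c_s\ge 0$, $s\ge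 0$, be the two developments of $h_{R/I}$ of these shapes. For $i\ge 1$ put $p_i=\#\{j\mid c'_j\ge i-1\}$ and $s_i=\#\{j\mid c_j\ge i-1\}$. Then $p_i\le s_i$ for all $i\ge 1$. -/

import Mathlib

open Polynomial

attribute [local instance] MvPolynomial.gradedAlgebra

/-- A local ring is equicharacteristic if it has the same characteristic as its residue field. -/
def IsEquicharacteristic (R₀ : Type*) [CommRing R₀] [IsLocalRing R₀] : Prop :=
  ringChar R₀ = ringChar (IsLocalRing.ResidueField R₀)

/-- The Hilbert function of `R / I`, where `R = R₀[X_1, …, X_b]` and `I` is a homogeneous ideal: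
`n ↦ λ_{R₀}(R_n / I_n)` with `I_n = I ∩ R_n`. Over an Artinian ring `R₀` the length is finite,
so that `ENat.toNat` loses nothing. -/
noncomputable def hilbertFunction {R₀ : Type*} [CommRing R₀] {b : ℕ}
    (I : Ideal (MvPolynomial (Fin b) R₀)) (n : ℕ) : ℕ :=
  (Module.length R₀
    (MvPolynomial.homogeneousSubmodule (Fin b) R₀ n ⧸
      (I.restrictScalars R₀).submoduleOf (MvPolynomial.homogeneousSubmodule (Fin b) R₀ n))).toNat

/-- `h` is the Hilbert polynomial `h_{R/I}`: the (necessarily unique) polynomial that agrees with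
the Hilbert function of `R / I` at all large `n`. -/
def IsHilbertPolynomial {R₀ : Type*} [CommRing R₀] {b : ℕ}
    (I : Ideal (MvPolynomial (Fin b) R₀)) (h : ℚ[X]) : Prop :=
  ∀ᶠ n : ℕ in Filter.atTop, h.eval (n : ℚ) = (hilbertFunction I n : ℚ)

/-- The polynomial
`binom (X + c_1) c_1 + binom (X + c_2 - 1) c_2 + ⋯ + binom (X + c_s - (s - 1)) c_s`.
With indices starting from `0`, the summands are `binom (X + c j - j) (c j)` for `j = 0, …, s - 1`,
and `Polynomial.preHilbertPoly ℚ d k` is the polynomial `binom (X - k + d) d`. -/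
noncomputable def gotzmannSum {s : ℕ} (c : Fin s → ℕ) : ℚ[X] :=
  ∑ j : Fin s, preHilbertPoly ℚ (c j) (j : ℕ)

/-- `h = binom (X + c_1) c_1 + ⋯ + binom (X + c_s - (s - 1)) c_s` with `c_1 ≥ ⋯ ≥ c_s ≥ 0`. -/
structure IsGotzmannDevelopment (h : ℚ[X]) {s : ℕ} (c : Fin s → ℕ) : Prop where
  antitone : Antitone c
  eq : h = gotzmannSum c

/-- `h = q * binom (X + b - 1) (b - 1) + binom (X + c'_1) c'_1 + ⋯ + binom (X + c'_p - (p - 1)) c'_p`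
with `b - 1 > c'_1 ≥ ⋯ ≥ c'_p ≥ 0`, `p ≥ 0` and `0 ≤ q ≤ λ_{R₀}(R₀)` (meant for `b ≥ 1`). -/
structure IsEuclideanDevelopment (R₀ : Type*) [CommRing R₀] (b : ℕ) (h : ℚ[X])
    (q : ℕ) {p : ℕ} (c' : Fin p → ℕ) : Prop where
  le_length : (q : ℕ∞) ≤ Module.length R₀ R₀
  antitone : Antitone c'
  lt : ∀ j, c' j + 1 < b
  eq : h = (q : ℚ[X]) * preHilbertPoly ℚ (b - 1) 0 + gotzmannSum c'

/-- The number of indices `j` with `c_j ≥ i - 1` (for `i ≥ 1`). -/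
def countGE {s : ℕ} (c : Fin s → ℕ) (i : ℕ) : ℕ :=
  (Finset.univ.filter fun j : Fin s => i ≤ c j + 1).card

/-! Write `P d k` for `preHilbertPoly ℚ d k`. Iterating Pascal's rule turns a Gotzmann sum into
`countPoly N σ`, where `σ i` counts the exponents `≥ i`; leading coefficients then recover `σ` from
the polynomial (`eq_of_countPoly_eq`). Adding a copy of `P (b - 1) 0` only raises these counts
(`exists_countPoly_eq_add`): the copy equals the next admissible summand of degree `b - 1` plus
summands of degree `b - 2`, which are absorbed by recursion on the degree. So the counts for `c'`
are at most those for `c`. -/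

/-- Pascal's rule for the polynomials `binom (X - k + d) d`. -/
lemma preHilbertPoly_succ_eq_add (d k : ℕ) :
    preHilbertPoly ℚ (d + 1) k = preHilbertPoly ℚ (d + 1) (k + 1) + preHilbertPoly ℚ d k := by
  refine eq_of_infinite_eval_eq _ _ (Set.Infinite.mono ?_
    ((Set.Ici_infinite (k + 1)).image (Nat.cast_injective (R := ℚ)).injOn))
  rintro _ ⟨n, hn, rfl⟩
  have hn : k + 1 ≤ n := hn
  simp only [Set.mem_ofPred_eq, eval_add]
  rw [preHilbertPoly_eq_choose_sub_add ℚ _ (by omega : k ≤ n),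
    preHilbertPoly_eq_choose_sub_add ℚ _ hn,
    preHilbertPoly_eq_choose_sub_add ℚ _ (by omega : k ≤ n)]
  obtain ⟨m, rfl⟩ := Nat.exists_eq_add_of_le hn
  rw [show k + 1 + m - k + (d + 1) = (m + (d + 1)) + 1 by omega,
    show k + 1 + m - (k + 1) + (d + 1) = m + (d + 1) by omega,
    show k + 1 + m - k + d = m + (d + 1) by omega, Nat.choose_succ_succ, Nat.cast_add, add_comm]

lemma preHilbertPoly_zero (k : ℕ) : preHilbertPoly ℚ 0 k = 1 := by
  simp [preHilbertPoly]

lemma preHilbertPoly_eq_sum_range (d k : ℕ) :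
    preHilbertPoly ℚ d k = ∑ i ∈ Finset.range (d + 1), preHilbertPoly ℚ i (k + 1) := by
  induction d with
  | zero => simp [preHilbertPoly_zero]
  | succ d ih => rw [Finset.sum_range_succ, ← ih, preHilbertPoly_succ_eq_add, add_comm]

lemma preHilbertPoly_succ_eq_add_sum (d t n : ℕ) :
    preHilbertPoly ℚ (d + 1) t =
      preHilbertPoly ℚ (d + 1) (t + n) + ∑ u ∈ Finset.range n, preHilbertPoly ℚ d (t + u) := by
  induction n with
  | zero => simp
  | succ n ih =>
    rw [Finset.sum_range_succ, ih, preHilbertPoly_succ_eq_add d (t + n), Nat.add_assoc t n 1]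
    ring

/-- The polynomial with `σ i` summands of degree `i` for each `i < N` that is the Gotzmann sum
of the sequence with exactly `σ i` members `≥ i`. -/
noncomputable def countPoly (N : ℕ) (σ : ℕ → ℕ) : ℚ[X] :=
  ∑ i ∈ Finset.range N, ∑ u ∈ Finset.range (σ i), preHilbertPoly ℚ i (u + 1)

lemma countPoly_succ (N : ℕ) (σ : ℕ → ℕ) :
    countPoly (N + 1) σ =
      countPoly N σ + ∑ u ∈ Finset.range (σ N), preHilbertPoly ℚ N (u + 1) :=
  Finset.sum_range_succ _ _

lemma countPoly_update_succ {N d : ℕ} (hd : d < N) (σ : ℕ → ℕ) :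
    countPoly N (Function.update σ d (σ d + 1)) =
      countPoly N σ + preHilbertPoly ℚ d (σ d + 1) := by
  have hd' := Finset.mem_range.2 hd
  unfold countPoly
  rw [← Finset.add_sum_erase _ _ hd', ← Finset.add_sum_erase (a := d) _ _ hd']
  have : ∀ i ∈ (Finset.range N).erase d,
      ∑ u ∈ Finset.range (Function.update σ d (σ d + 1) i), preHilbertPoly ℚ i (u + 1) =
        ∑ u ∈ Finset.range (σ i), preHilbertPoly ℚ i (u + 1) := fun i hi => by
    rw [Function.update_of_ne (Finset.ne_of_mem_erase hi)]
  rw [Finset.sum_congr rfl this, Function.update_self, Finset.sum_range_succ]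
  ring

lemma antitone_update_succ {σ : ℕ → ℕ} (hσ : Antitone σ) {d : ℕ} (h : σ (d + 1) < σ d) :
    Antitone (Function.update σ (d + 1) (σ (d + 1) + 1)) := by
  intro i j hij
  rcases eq_or_ne j (d + 1) with rfl | hj
  · rcases eq_or_ne i (d + 1) with rfl | hi
    · rfl
    · rw [Function.update_self, Function.update_of_ne hi]
      exact h.trans_le (hσ (by omega))
  · rw [Function.update_of_ne hj]
    rcases eq_or_ne i (d + 1) with rfl | hi
    · rw [Function.update_self]
      exact (hσ hij).trans (Nat.le_succ _)
    · rw [Function.update_of_ne hi]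
      exact hσ hij

lemma coeff_countPoly_of_le {N n : ℕ} (h : N ≤ n) (σ : ℕ → ℕ) : (countPoly N σ).coeff n = 0 := by
  simp only [countPoly, finsetSum_coeff]
  refine Finset.sum_eq_zero fun i hi => Finset.sum_eq_zero fun u _ => ?_
  refine coeff_eq_zero_of_natDegree_lt ?_
  rw [natDegree_preHilbertPoly]
  exact (Finset.mem_range.1 hi).trans_le h

/-- Each `P N k` has leading coefficient `1 / N!`, so the coefficient of `X ^ N` reads off the top
count; cancelling that block leaves the smaller degrees. -/
lemma eq_of_countPoly_eq {N : ℕ} {σ τ : ℕ → ℕ} (h : countPoly N σ = countPoly N τ) :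
    ∀ i < N, σ i = τ i := by
  induction N with
  | zero => simp
  | succ N ih =>
    have key (ρ : ℕ → ℕ) :
        (countPoly (N + 1) ρ).coeff N = ρ N * (N.factorial : ℚ)⁻¹ := by
      rw [countPoly_succ, coeff_add, coeff_countPoly_of_le le_rfl, finsetSum_coeff]
      simp [coeff_preHilbertPoly_self]
    have hN : σ N = τ N := by
      have := congrArg (coeff · N) h
      simp only [key] at this
      exact_mod_cast mul_right_cancel₀ (by positivity) this
    rw [countPoly_succ, countPoly_succ, hN] at h
    intro i hi
    rcases Nat.lt_succ_iff_lt_or_eq.1 hi with hi | rfl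
    · exact ih (add_right_cancel h) i hi
    · exact hN

/-- The bound on `n` says that every shift `t + u` with `u < n` is at most `σ d`. It stays
admissible because counts never decrease. -/
lemma exists_countPoly_eq_add_sum {N d t : ℕ}
    (H : ∀ σ : ℕ → ℕ, Antitone σ → ∀ t ≤ σ d, ∃ τ : ℕ → ℕ, Antitone τ ∧ σ ≤ τ ∧
      (∀ i, d < i → τ i = σ i) ∧ σ d < τ d ∧
      countPoly N τ = countPoly N σ + preHilbertPoly ℚ d t)
    {σ : ℕ → ℕ} (hσ : Antitone σ) (n : ℕ) (hn : t + n ≤ σ d + 1) :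
    ∃ τ : ℕ → ℕ, Antitone τ ∧ σ ≤ τ ∧ (∀ i, d < i → τ i = σ i) ∧ (0 < n → σ d < τ d) ∧
      countPoly N τ = countPoly N σ + ∑ u ∈ Finset.range n, preHilbertPoly ℚ d (t + u) := by
  induction n with
  | zero => exact ⟨σ, hσ, le_rfl, fun _ _ => rfl, by simp, by simp⟩
  | succ n ih =>
    obtain ⟨τ, hτ, hle, heq, -, hpoly⟩ := ih (by omega)
    have hd : σ d ≤ τ d := hle d
    obtain ⟨υ, hυ, hle', heq', hlt', hpoly'⟩ := H τ hτ (t + n) (by omega)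
    refine ⟨υ, hυ, hle.trans hle', fun i hi => (heq' i hi).trans (heq i hi),
      fun _ => hd.trans_lt hlt', ?_⟩
    rw [hpoly', hpoly, Finset.sum_range_succ, add_assoc]

/-- Adding `binom (X - t + d) d` to a Gotzmann sum with at least `t` terms of degree `≥ d` gives
a Gotzmann sum with at least as many terms in each range of degrees. -/
lemma exists_countPoly_eq_add {N d : ℕ} (hd : d < N) :
    ∀ σ : ℕ → ℕ, Antitone σ → ∀ t ≤ σ d, ∃ τ : ℕ → ℕ, Antitone τ ∧ σ ≤ τ ∧
      (∀ i, d < i → τ i = σ i) ∧ σ d < τ d ∧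
      countPoly N τ = countPoly N σ + preHilbertPoly ℚ d t := by
  induction d with
  | zero =>
    intro σ hσ t _
    refine ⟨Function.update σ 0 (σ 0 + 1), ?_, ?_, ?_, by simp, ?_⟩
    · intro i j hij
      rcases Nat.eq_zero_or_pos j with rfl | hj
      · rw [Nat.le_zero.1 hij]
      · rw [Function.update_of_ne hj.ne']
        rcases Nat.eq_zero_or_pos i with rfl | hi
        · rw [Function.update_self]
          exact (hσ hij).trans (Nat.le_succ _)
        · rw [Function.update_of_ne hi.ne']
          exact hσ hij
    · exact le_update_self_iff.2 (Nat.le_succ _)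
    · exact fun i hi => Function.update_of_ne hi.ne' _ _
    · rw [countPoly_update_succ hd, preHilbertPoly_zero, preHilbertPoly_zero]
  | succ d ih =>
    intro σ hσ t ht
    have hmono : σ (d + 1) ≤ σ d := hσ (Nat.le_succ d)
    -- The shifts run over `t, …, σ (d + 1)`, leaving `P (d + 1) (σ (d + 1) + 1)`, exactly what
    -- raising the count at `d + 1` by one contributes. As `t ≤ σ (d + 1)`, the range is nonempty,
    -- so the count at `d` grows strictly and the raised sequence stays antitone.
    obtain ⟨τ, hτ, hle, heq, hlt, hpoly⟩ := exists_countPoly_eq_add_sum (t := t)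
      (ih (by omega)) hσ (σ (d + 1) + 1 - t) (by omega)
    have hd1 : τ (d + 1) = σ (d + 1) := heq _ (Nat.lt_succ_self d)
    refine ⟨Function.update τ (d + 1) (τ (d + 1) + 1),
      antitone_update_succ hτ (hd1 ▸ hmono.trans_lt (hlt (by omega))),
      hle.trans (le_update_self_iff.2 (Nat.le_succ _)), fun i hi => ?_, ?_, ?_⟩
    · rw [Function.update_of_ne hi.ne', heq i (by omega)]
    · rw [Function.update_self, hd1]
      exact Nat.lt_succ_self _
    · rw [countPoly_update_succ hd, hpoly, hd1,
        preHilbertPoly_succ_eq_add_sum d t (σ (d + 1) + 1 - t), Nat.add_sub_cancel' (by omega)]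
      ring

lemma exists_countPoly_eq_add_mul {N d : ℕ} (hd : d < N) {σ : ℕ → ℕ} (hσ : Antitone σ) (q : ℕ) :
    ∃ τ : ℕ → ℕ, Antitone τ ∧ σ ≤ τ ∧
      countPoly N τ = countPoly N σ + (q : ℚ[X]) * preHilbertPoly ℚ d 0 := by
  induction q with
  | zero => exact ⟨σ, hσ, le_rfl, by simp⟩
  | succ q ih =>
    obtain ⟨τ, hτ, hle, hpoly⟩ := ih
    obtain ⟨υ, hυ, hle', -, -, hpoly'⟩ := exists_countPoly_eq_add hd τ hτ 0 (Nat.zero_le _)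
    refine ⟨υ, hυ, hle.trans hle', ?_⟩
    rw [hpoly', hpoly]
    push_cast
    ring

lemma antitone_countGE {s : ℕ} (c : Fin s → ℕ) : Antitone fun i => countGE c (i + 1) := by
  intro i j hij
  refine Finset.card_le_card (Finset.monotone_filter_right _ fun k _ hk => ?_)
  omega

/-- Conjugation of partitions: for antitone `c`, the indices with `c j ≥ i` form an initial segment.
-/
lemma le_iff_lt_countGE {s : ℕ} {c : Fin s → ℕ} (hc : Antitone c) (i : ℕ) (j : Fin s) :
    i ≤ c j ↔ (j : ℕ) < countGE c (i + 1) := by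
  constructor
  · intro h
    have : Finset.Iic j ⊆ Finset.univ.filter fun k : Fin s => i + 1 ≤ c k + 1 := by
      intro k hk
      have := hc (Finset.mem_Iic.1 hk)
      simp only [Finset.mem_filter, Finset.mem_univ, true_and]
      omega
    have := Finset.card_le_card this
    rw [Fin.card_Iic] at this
    exact this
  · contrapose!
    intro h
    have : (Finset.univ.filter fun k : Fin s => i + 1 ≤ c k + 1) ⊆ Finset.Iio j := by
      intro k hk
      simp only [Finset.mem_filter, Finset.mem_univ, true_and] at hk
      rw [Finset.mem_Iio]
      by_contra! hjk
      have := hc hjk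
      omega
    have := Finset.card_le_card this
    rw [Fin.card_Iio] at this
    exact this

lemma gotzmannSum_eq_countPoly {s : ℕ} {c : Fin s → ℕ} (hc : Antitone c) {N : ℕ}
    (hN : ∀ j, c j < N) : gotzmannSum c = countPoly N fun i => countGE c (i + 1) := by
  have hterm (j : Fin s) : preHilbertPoly ℚ (c j) j =
      ∑ i ∈ Finset.range N, if (j : ℕ) < countGE c (i + 1) then
        preHilbertPoly ℚ i (j + 1) else 0 := by
    rw [preHilbertPoly_eq_sum_range, ← Finset.sum_filter]
    refine Finset.sum_congr ?_ fun _ _ => rfl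
    ext i
    have := hN j
    rw [Finset.mem_filter, ← le_iff_lt_countGE hc, Finset.mem_range, Finset.mem_range]
    omega
  rw [gotzmannSum, Finset.sum_congr rfl fun j _ => hterm j, Finset.sum_comm, countPoly]
  refine Finset.sum_congr rfl fun i _ => ?_
  have hle : countGE c (i + 1) ≤ s := (Finset.card_le_univ _).trans_eq (Fintype.card_fin s)
  rw [Fin.sum_univ_eq_sum_range
    (fun j => if j < countGE c (i + 1) then preHilbertPoly ℚ i (j + 1) else 0), ← Finset.sum_filter]
  refine Finset.sum_congr ?_ fun _ _ => rfl
  ext j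
  rw [Finset.mem_filter, Finset.mem_range, Finset.mem_range]
  omega

theorem proposition4p13 {R₀ : Type*} [CommRing R₀] [IsLocalRing R₀] [IsArtinianRing R₀]
    (hR₀ : IsEquicharacteristic R₀) {b : ℕ}
    (I : Ideal (MvPolynomial (Fin b) R₀))
    (hI : I.IsHomogeneous (MvPolynomial.homogeneousSubmodule (Fin b) R₀))
    (hI_irrelevant :
      I ≤ (HomogeneousIdeal.irrelevant (MvPolynomial.homogeneousSubmodule (Fin b) R₀)).toIdeal)
    (hdim : 1 ≤ ringKrullDim (MvPolynomial (Fin b) R₀ ⧸ I))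
    (h : ℚ[X]) (hh : IsHilbertPolynomial I h)
    (q p : ℕ) (c' : Fin p → ℕ) (hc' : IsEuclideanDevelopment R₀ b h q c')
    (s : ℕ) (c : Fin s → ℕ) (hc : IsGotzmannDevelopment h c)
    (i : ℕ) (hi : 1 ≤ i) :
    countGE c' i ≤ countGE c i := by
  obtain ⟨i, rfl⟩ : ∃ k, i = k + 1 := ⟨i - 1, by omega⟩
  -- `N` exceeds `b - 1`, every exponent and the index `i` under comparison.
  let N := (b - 1) + (i + 1) + ∑ j, c j + ∑ j, c' j
  have hcN (j) : c j < N := by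
    have := Finset.single_le_sum (f := c) (fun _ _ => Nat.zero_le _) (Finset.mem_univ j)
    omega
  have hcN' (j) : c' j < N := by
    have := Finset.single_le_sum (f := c') (fun _ _ => Nat.zero_le _) (Finset.mem_univ j)
    omega
  obtain ⟨τ, -, hle, hpoly⟩ :=
    exists_countPoly_eq_add_mul (N := N) (d := b - 1) (by omega) (antitone_countGE c') q
  have heq : countPoly N (fun i => countGE c (i + 1)) = countPoly N τ := by
    rw [hpoly, ← gotzmannSum_eq_countPoly hc.antitone hcN,
      ← gotzmannSum_eq_countPoly hc'.antitone hcN', ← hc.eq, hc'.eq, add_comm]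
  exact (hle i).trans_eq (eq_of_countPoly_eq heq i (by omega)).symm
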